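/- Let $\mathcal H_A,\mathcal H_B,\mathcal H_C$ be finite-dimensional complex Hilbert spaces. For a Hilbert space $\mathcal H$ let $\mathcal S_{\le}(\mathcal H)$ be the set of positive semidefinite operators on $\mathcal H$ with trace at most $1$. For positive semidefinite $\rho,\tau$ let $F(\rho,\tau)=\|\sqrt\rho\sqrt\tau\|_1$, where $\|R\|_1=\operatorname{tr}\sqrt{R^\dagger R}$, and let $\log$ be the logarithm to base $2$, with $\log 0=-\infty$. For $\rho_{AB}\in\mathcal S_{\le}(\mathcal H_A\otimes\mathcal H_B)$ and $\sigma_B\in\mathcal S_{\le}(\mathcal H_B)$ define $$H_{\max}(A|B)_{\rho|\sigma}=\log F(\rho_{AB},1_A\otimes\sigma_B)^2,\qquad H_{\max}(A|B)_\rho=\sup_{\sigma_B\in\mathcal S_{\le}(\mathcal H_B)}H_{\max}(A|B)_{\rho|\sigma}.$$ Let $\rho_{AB}\in\mathcal S_{\le}(\mathcal H_A\otimes\mathcal H_B)$ and let $\rho_{ABC}=|\psi\rangle\langle\psi|$ be a purification of it, i.e. $\psi\in\mathcal H_A\otimes\mathcal H_B\otimes\mathcal H_C$ (not necessarily normalized)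 and $\operatorname{tr}_C\rho_{ABC}=\rho_{AB}$. Let $\mathcal Z$ be the set of positive semidefinite operators $Z_{AB}$ on $\mathcal H_A\otimes\mathcal H_B$ with $\rho_{ABC}\le Z_{AB}\otimes 1_C$. Then: 1. The supremum defining $H_{\max}(A|B)_\rho$ is attained, and $$H_{\max}(A|B)_\rho=\log\min_{Z_{AB}\in\mathcal Z}\|Z_B\|_\infty,\qquad Z_B=\operatorname{tr}_A Z_{AB},$$ where $\|\cdot\|_\infty$ is the operator norm and the minimum is attained. 2. For every $\sigma_B\in\mathcal S_{\le}(\mathcal H_B)$, $$H_{\max}(A|B)_{\rho|\sigma}=\log\inf_{Z_{AB}\in\mathcal Z}\operatorname{tr}\bigl[(1_A\otimes\sigma_B)Z_{AB}\bigr],$$ and the infimum is a minimum whenever $\operatorname{supp}\rho_B\subseteq\operatorname{supp}\sigma_B$, where $\rho_B=\operatorname{tr}_A\rho_{AB}$ (in particular whenever $\sigma_B$ is positive definite). -/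

import Mathlib

open scoped MatrixOrder Kronecker

noncomputable section

namespace MaxEntropy

/-! Operators on finite-dimensional Hilbert spaces with fixed orthonormal bases are complex
matrices; the tensor product of the spaces indexed by `a` and `b` is indexed by `a × b`.
The order on matrices is the Loewner order (`MatrixOrder`), and `⊗ₖ` is the tensor product
of operators. -/

/-- Partial trace over the first tensor factor. -/
def trFst {a b : Type*} [Fintype a] (M : Matrix (a × b) (a × b) ℂ) : Matrix b b ℂ :=
  Matrix.of fun i j => ∑ x, M (x, i) (x, j)

/-- Partial trace over the second tensor factor. -/
def trSnd {a b : Type*} [Fintype b] (M : Matrix (a × b) (a × b) ℂ) : Matrix a a ℂ :=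
  Matrix.of fun i j => ∑ y, M (i, y) (j, y)

/-- Sub-normalized density operators: positive semidefinite with trace at most one. -/
def subStates (a : Type*) [Fintype a] : Set (Matrix a a ℂ) :=
  {ρ | 0 ≤ ρ ∧ ρ.trace.re ≤ 1}

/-- `ρABC` is a purification of `ρAB`: it has the form `|ψ⟩⟨ψ|` (the vector `ψ` need not be
normalized) and its marginal on the first two systems is `ρAB`. -/
def IsPurification {a b c : Type*} [Fintype c]
    (ρABC : Matrix ((a × b) × c) ((a × b) × c) ℂ) (ρAB : Matrix (a × b) (a × b) ℂ) : Prop :=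
  (∃ ψ : (a × b) × c → ℂ, ρABC = Matrix.vecMulVec ψ (star ψ)) ∧ trSnd ρABC = ρAB

/-- The operator norm with respect to the Euclidean norm (the largest singular value). -/
def opNorm {a : Type*} [Fintype a] [DecidableEq a] (M : Matrix a a ℂ) : ℝ :=
  ‖Matrix.toEuclideanCLM (n := a) (𝕜 := ℂ) M‖

/-- The trace norm `tr √(M† M)`. -/
def traceNorm {a : Type*} [Fintype a] [DecidableEq a] (M : Matrix a a ℂ) : ℝ :=
  (CFC.sqrt (M.conjTranspose * M)).trace.re

/-- The fidelity `F(ρ, τ) = ‖√ρ √τ‖₁` of positive semidefinite operators. -/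
def fidelity {a : Type*} [Fintype a] [DecidableEq a] (ρ τ : Matrix a a ℂ) : ℝ :=
  traceNorm (CFC.sqrt ρ * CFC.sqrt τ)

/-- The binary logarithm of a nonnegative real, with value `-∞` at zero. -/
def log2 (x : ℝ) : EReal :=
  if x ≤ 0 then ⊥ else ((Real.logb 2 x : ℝ) : EReal)

/-- The conditional max-entropy of `A` given `B` of `ρ` relative to `σ`:
`log F(ρ, 1 ⊗ σ)²`. -/
def hmaxRel {a b : Type*} [Fintype a] [Fintype b] [DecidableEq a] [DecidableEq b]
    (ρ : Matrix (a × b) (a × b) ℂ) (σ : Matrix b b ℂ) : EReal :=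
  log2 (fidelity ρ ((1 : Matrix a a ℂ) ⊗ₖ σ) ^ 2)

/-- The conditional max-entropy of `A` given `B` of `ρ`: the supremum of the relative one over
sub-normalized states `σ` on `B`. -/
def hmax {a b : Type*} [Fintype a] [Fintype b] [DecidableEq a] [DecidableEq b]
    (ρ : Matrix (a × b) (a × b) ℂ) : EReal :=
  ⨆ σ ∈ subStates b, hmaxRel ρ σ

/-- The positive semidefinite `Z` on `AB` with `ρABC ≤ Z ⊗ 1` on `ABC`. -/
def dominating {a b c : Type*} [DecidableEq c]
    (ρABC : Matrix ((a × b) × c) ((a × b) × c) ℂ) : Set (Matrix (a × b) (a × b) ℂ) :=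
  {Z | 0 ≤ Z ∧ ρABC ≤ Z ⊗ₖ (1 : Matrix c c ℂ)}

end MaxEntropy

end

/-! Reshape the purifying vector into a matrix `X` with `ρAB = X * Xᴴ`, and put `S = √(1 ⊗ σ)`, `H =
√(S X Xᴴ S)`, so that the fidelity is `tr H`. Domination by `Z ⊗ 1` then says `|tr (Xᴴ Y)|² ≤ tr (Yᴴ
Z Y)` for all `Y` (`vecMulVec_ket_le_iff`).

For a lower bound on `tr (S² Z)`, test with `Y = S R S X`, where `R = (H + ε)⁻¹`: the left side
tends to `(tr H)²`, the right side is at most `tr (S² Z)` (`sq_trace_le_of_dominating`). For the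
matching upper bound, a factorization `X = K W` with `W` of Hilbert–Schmidt norm at most one gives
domination by `K Kᴴ`, by Cauchy–Schwarz. Formally `K = √(tr H) S⁻¹ √H` yields `Z = tr H • S⁻¹ H S⁻¹`
with `tr (S² Z) = (tr H)²`. Regularizing both inverses gives the infimum
(`exists_dominating_trace_lt`); a generalized inverse of `S` gives attainment under the support
condition (`exists_dominating_trace_le_of_ker`).

The unconditioned entropy follows from Sion's theorem for the bilinear pairing `tr (σ Z_B)` on
compact convex states and closed convex dominating operators: the supremum over `σ` at fixed `Z` is
the norm of `Z_B`, and the infimum over `Z` at fixed `σ` is the squared fidelity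
(`exists_isMaxOn_and_isLeast`). -/

namespace MaxEntropy

open Matrix
open scoped ComplexOrder

/-! ### Hilbert–Schmidt inner product and monotonicity of traces -/

section Trace

variable {m n : Type*} [Fintype m] [Fintype n]

/-- The vector in the tensor product whose coefficients are the entries of a matrix. -/
def ket (X : Matrix m n ℂ) : m × n → ℂ := fun p => X p.1 p.2

theorem trace_conjTranspose_mul_eq_dotProduct (A B : Matrix m n ℂ) :
    (Aᴴ * B).trace = star (ket A) ⬝ᵥ ket B := by
  simp only [trace, diag_apply, mul_apply, conjTranspose_apply, dotProduct, ket, Pi.star_apply,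
    Fintype.sum_prod_type]
  exact Finset.sum_comm

theorem trace_conjTranspose_mul_self_re_nonneg (A : Matrix m n ℂ) : 0 ≤ (Aᴴ * A).trace.re :=
  (Complex.nonneg_iff.mp (posSemidef_conjTranspose_mul_self A).trace_nonneg).1

/-- The Cauchy–Schwarz inequality for the Hilbert–Schmidt inner product. -/
theorem normSq_trace_conjTranspose_mul_le (A B : Matrix m n ℂ) :
    Complex.normSq (Aᴴ * B).trace ≤ (Aᴴ * A).trace.re * (Bᴴ * B).trace.re := by
  have key : ∀ C D : Matrix m n ℂ, (Cᴴ * D).trace =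
      inner ℂ (WithLp.toLp 2 (ket C)) (WithLp.toLp 2 (ket D)) := by
    intro C D
    rw [trace_conjTranspose_mul_eq_dotProduct, EuclideanSpace.inner_eq_star_dotProduct,
      dotProduct_comm]
  have hs : ∀ C : Matrix m n ℂ, (Cᴴ * C).trace.re = ‖WithLp.toLp 2 (ket C)‖ ^ 2 := by
    intro C
    rw [key, inner_self_eq_norm_sq_to_K]
    norm_cast
  rw [hs, hs, Complex.normSq_eq_norm_sq, key, ← mul_pow]
  exact pow_le_pow_left₀ (norm_nonneg _) (norm_inner_le_norm _ _) 2

theorem trace_mul_re_nonneg {A B : Matrix n n ℂ} (hA : 0 ≤ A) (hB : 0 ≤ B) :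
    0 ≤ (A * B).trace.re := by
  classical
  obtain ⟨C, rfl⟩ := CStarAlgebra.nonneg_iff_eq_star_mul_self.mp hA
  rw [star_eq_conjTranspose, Matrix.mul_assoc, trace_mul_comm]
  exact (Complex.nonneg_iff.mp
    (hB.posSemidef.mul_mul_conjTranspose_same C).trace_nonneg).1

theorem trace_mul_re_le_of_le_left {A B C : Matrix n n ℂ} (h : A ≤ B) (hC : 0 ≤ C) :
    (A * C).trace.re ≤ (B * C).trace.re := by
  have := trace_mul_re_nonneg (sub_nonneg.mpr h) hC
  rw [Matrix.sub_mul, trace_sub, Complex.sub_re] at this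
  linarith

theorem trace_mul_re_le_of_le_right {A B C : Matrix n n ℂ} (h : A ≤ B) (hC : 0 ≤ C) :
    (C * A).trace.re ≤ (C * B).trace.re := by
  rw [trace_mul_comm C A, trace_mul_comm C B]
  exact trace_mul_re_le_of_le_left h hC

theorem trace_re_nonneg {A : Matrix n n ℂ} (hA : 0 ≤ A) : 0 ≤ A.trace.re :=
  (Complex.nonneg_iff.mp hA.posSemidef.trace_nonneg).1

theorem trace_re_le_of_le {A B : Matrix n n ℂ} (h : A ≤ B) : A.trace.re ≤ B.trace.re := by
  have := trace_re_nonneg (sub_nonneg.mpr h)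
  rw [trace_sub, Complex.sub_re] at this
  linarith

end Trace

/-! ### Domination of a rank-one operator by `Z ⊗ 1` -/

section Dominating

variable {n c : Type*} [Fintype n] [Fintype c]

theorem dotProduct_vecMulVec_ket (X Y : Matrix n c ℂ) :
    star (ket Y) ⬝ᵥ (vecMulVec (ket X) (star (ket X))) *ᵥ ket Y =
      Complex.normSq (Xᴴ * Y).trace := by
  rw [vecMulVec_mulVec, ← trace_conjTranspose_mul_eq_dotProduct, dotProduct_smul,
    ← trace_conjTranspose_mul_eq_dotProduct, op_smul_eq_smul, smul_eq_mul,
    Complex.normSq_eq_conj_mul_self, mul_comm]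
  congr 1
  rw [← Complex.star_def, ← trace_conjTranspose, conjTranspose_mul, conjTranspose_conjTranspose]

variable [DecidableEq c]

theorem kronecker_one_mulVec_ket (Z : Matrix n n ℂ) (Y : Matrix n c ℂ) :
    (Z ⊗ₖ (1 : Matrix c c ℂ)) *ᵥ ket Y = ket (Z * Y) := by
  ext ⟨i, k⟩
  simp [mulVec, dotProduct, ket, kroneckerMap_apply, Fintype.sum_prod_type, mul_apply, one_apply]

theorem dotProduct_kronecker_one_ket (Z : Matrix n n ℂ) (Y : Matrix n c ℂ) :
    star (ket Y) ⬝ᵥ (Z ⊗ₖ (1 : Matrix c c ℂ)) *ᵥ ket Y = (Yᴴ * Z * Y).trace := by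
  rw [kronecker_one_mulVec_ket, ← trace_conjTranspose_mul_eq_dotProduct, Matrix.mul_assoc]

/-- Domination of a rank-one operator by `Z ⊗ 1`, tested on vectors of the tensor product. -/
theorem vecMulVec_ket_le_iff {Z : Matrix n n ℂ} (hZ : 0 ≤ Z) (X : Matrix n c ℂ) :
    vecMulVec (ket X) (star (ket X)) ≤ Z ⊗ₖ (1 : Matrix c c ℂ) ↔
      ∀ Y : Matrix n c ℂ, Complex.normSq (Xᴴ * Y).trace ≤ (Yᴴ * Z * Y).trace.re := by
  have hpos : ∀ Y : Matrix n c ℂ, 0 ≤ (Yᴴ * Z * Y).trace := fun Y =>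
    (hZ.posSemidef.conjTranspose_mul_mul_same Y).trace_nonneg
  rw [Matrix.le_iff, posSemidef_iff_dotProduct_mulVec]
  have hherm : (Z ⊗ₖ (1 : Matrix c c ℂ) - vecMulVec (ket X) (star (ket X))).IsHermitian :=
    (hZ.posSemidef.kronecker PosSemidef.one).isHermitian.sub
      (posSemidef_vecMulVec_self_star (ket X)).isHermitian
  have key : ∀ Y : Matrix n c ℂ, 0 ≤ star (ket Y) ⬝ᵥ
      (Z ⊗ₖ (1 : Matrix c c ℂ) - vecMulVec (ket X) (star (ket X))) *ᵥ ket Y ↔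
        Complex.normSq (Xᴴ * Y).trace ≤ (Yᴴ * Z * Y).trace.re := by
    intro Y
    rw [sub_mulVec, dotProduct_sub, dotProduct_vecMulVec_ket, dotProduct_kronecker_one_ket,
      sub_nonneg, Complex.le_def]
    have h2 := (Complex.nonneg_iff.mp (hpos Y)).2
    simp [← h2]
  refine ⟨fun h Y => (key Y).mp (h.2 _), fun h => ⟨hherm, fun y => ?_⟩⟩
  exact (key (of fun i k => y (i, k))).mpr (h _)

/-- A dominating operator tested on the image of the purifying vector under `G ⊗ 1`. -/
theorem normSq_trace_mul_le {Z : Matrix n n ℂ} (hZ : 0 ≤ Z) {X : Matrix n c ℂ}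
    (h : vecMulVec (ket X) (star (ket X)) ≤ Z ⊗ₖ (1 : Matrix c c ℂ)) (G : Matrix n n ℂ) :
    Complex.normSq (X * Xᴴ * G).trace ≤ (G * (X * Xᴴ) * Gᴴ * Z).trace.re := by
  have := (vecMulVec_ket_le_iff hZ X).mp h (G * X)
  convert this using 3
  · rw [Matrix.mul_assoc, trace_mul_comm, Matrix.mul_assoc]
  · rw [conjTranspose_mul, trace_mul_comm, trace_mul_comm _ (G * X)]
    simp only [Matrix.mul_assoc]
    rw [trace_mul_comm]
    simp only [Matrix.mul_assoc]

/-- If `X = K W` with `W` of Hilbert–Schmidt norm at most one, then `K Kᴴ` dominates. -/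
theorem vecMulVec_ket_le_of_factor (K : Matrix n n ℂ) (W : Matrix n c ℂ)
    (hW : (Wᴴ * W).trace.re ≤ 1) :
    vecMulVec (ket (K * W)) (star (ket (K * W))) ≤ (K * Kᴴ) ⊗ₖ (1 : Matrix c c ℂ) := by
  rw [vecMulVec_ket_le_iff (posSemidef_self_mul_conjTranspose K).nonneg]
  intro Y
  have h := normSq_trace_conjTranspose_mul_le W (Kᴴ * Y)
  have h0 := trace_conjTranspose_mul_self_re_nonneg (Kᴴ * Y)
  have e1 : (K * W)ᴴ * Y = Wᴴ * (Kᴴ * Y) := by rw [conjTranspose_mul, Matrix.mul_assoc]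
  have e2 : Yᴴ * (K * Kᴴ) * Y = (Kᴴ * Y)ᴴ * (Kᴴ * Y) := by
    simp only [conjTranspose_mul, conjTranspose_conjTranspose, Matrix.mul_assoc]
  rw [e1, e2]
  nlinarith

/-- A sufficient criterion for a positive multiple of `A M A` to dominate. -/
theorem vecMulVec_ket_le_smul [DecidableEq n] {A B M : Matrix n n ℂ} (hA : A.IsHermitian)
    (hB : B.IsHermitian) (hM : M.PosDef) {X : Matrix n c ℂ} (hX : A * B * X = X) {t : ℝ}
    (ht : 0 < t) (h : (M⁻¹ * (B * (X * Xᴴ) * B)).trace.re ≤ t) :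
    vecMulVec (ket X) (star (ket X)) ≤ (t • (A * M * A)) ⊗ₖ (1 : Matrix c c ℂ) := by
  set Q := CFC.sqrt M with hQ
  have hQ0 : 0 ≤ Q := CFC.sqrt_nonneg M
  have hQQ : Q * Q = M := CFC.sqrt_mul_sqrt_self M hM.posSemidef.nonneg
  have hQh : Qᴴ = Q := hQ0.posSemidef.isHermitian
  have hMdet : IsUnit M.det := (isUnit_iff_isUnit_det M).mp hM.isUnit
  have hQdet : IsUnit Q.det := by
    rw [← hQQ, det_mul] at hMdet
    exact isUnit_of_mul_isUnit_left hMdet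
  have hQih : (Q⁻¹)ᴴ = Q⁻¹ := by rw [conjTranspose_nonsing_inv, hQh]
  have hMi : M⁻¹ = Q⁻¹ * Q⁻¹ := by rw [← hQQ, Matrix.mul_inv_rev]
  set s := Real.sqrt t
  have hs : 0 < s := Real.sqrt_pos.mpr ht
  have hss : s * s = t := Real.mul_self_sqrt ht.le
  -- The factors are `K = √t A √M` and `W = K⁻¹ X` in spirit, with `B` in the role of `A⁻¹`; the
  -- hypothesis on `t` is exactly the norm bound for `W`.
  have h1 := vecMulVec_ket_le_of_factor (s • (A * Q)) (s⁻¹ • (Q⁻¹ * B * X)) (by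
    rw [conjTranspose_smul, Matrix.smul_mul, Matrix.mul_smul, smul_smul, trace_smul, conjTranspose_mul,
      conjTranspose_mul, hQih, hB.eq, Complex.smul_re, star_trivial, ← mul_inv, hss, smul_eq_mul]
    have : (Xᴴ * (B * Q⁻¹) * (Q⁻¹ * B * X)).trace = (M⁻¹ * (B * (X * Xᴴ) * B)).trace := by
      rw [hMi, Matrix.mul_assoc Q⁻¹ Q⁻¹, trace_mul_comm Q⁻¹, trace_mul_comm (Xᴴ * _)]
      simp only [Matrix.mul_assoc]
    rw [this, inv_mul_le_iff₀ ht, mul_one]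
    exact h)
  have e1 : s • (A * Q) * s⁻¹ • (Q⁻¹ * B * X) = X := by
    rw [Matrix.smul_mul, Matrix.mul_smul, smul_smul, mul_inv_cancel₀ hs.ne', one_smul]
    calc A * Q * (Q⁻¹ * B * X) = A * (Q * Q⁻¹) * B * X := by simp only [Matrix.mul_assoc]
      _ = X := by rw [mul_nonsing_inv _ hQdet, Matrix.mul_one, hX]
  have e2 : s • (A * Q) * (s • (A * Q))ᴴ = t • (A * M * A) := by
    rw [conjTranspose_smul, star_trivial, Matrix.smul_mul, Matrix.mul_smul, smul_smul, hss, conjTranspose_mul,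
      hQh, hA.eq, ← hQQ]
    simp only [Matrix.mul_assoc]
  rwa [e1, e2] at h1

end Dominating

/-! ### Regularized inverses of positive semidefinite matrices -/

section Resolvent

variable {n : Type*} [DecidableEq n] {H : Matrix n n ℂ} {ε : ℝ}

theorem posDef_add_smul_one (hH : 0 ≤ H) (hε : 0 < ε) :
    (H + ε • (1 : Matrix n n ℂ)).PosDef :=
  PosDef.posSemidef_add hH.posSemidef (PosDef.one.smul hε)

variable [Fintype n]

theorem inv_add_smul_one_nonneg (hH : 0 ≤ H) (hε : 0 < ε) :
    0 ≤ (H + ε • (1 : Matrix n n ℂ))⁻¹ :=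
  (posDef_add_smul_one hH hε).inv.posSemidef.nonneg

theorem mul_inv_add_smul_one (hH : 0 ≤ H) (hε : 0 < ε) :
    H * (H + ε • (1 : Matrix n n ℂ))⁻¹ = 1 - ε • (H + ε • (1 : Matrix n n ℂ))⁻¹ := by
  have h := mul_nonsing_inv _
    ((isUnit_iff_isUnit_det _).mp (posDef_add_smul_one hH hε).isUnit)
  rw [Matrix.add_mul, Matrix.smul_mul, Matrix.one_mul] at h
  exact eq_sub_of_add_eq h

theorem inv_add_smul_one_mul (hH : 0 ≤ H) (hε : 0 < ε) :
    (H + ε • (1 : Matrix n n ℂ))⁻¹ * H = 1 - ε • (H + ε • (1 : Matrix n n ℂ))⁻¹ := by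
  have h := nonsing_inv_mul _
    ((isUnit_iff_isUnit_det _).mp (posDef_add_smul_one hH hε).isUnit)
  rw [Matrix.mul_add, Matrix.mul_smul, Matrix.mul_one] at h
  exact eq_sub_of_add_eq h

/-- Replaces `H⁻¹ H² = H`, with an explicit error term. The error lies between `0` and `ε` times the
dimension, whence the two bounds below. -/
theorem trace_inv_add_smul_one_mul_sq (hH : 0 ≤ H) (hε : 0 < ε) :
    ((H + ε • (1 : Matrix n n ℂ))⁻¹ * (H * H)).trace.re =
      H.trace.re - ε * (H * (H + ε • (1 : Matrix n n ℂ))⁻¹).trace.re := by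
  rw [← Matrix.mul_assoc, inv_add_smul_one_mul hH hε, Matrix.sub_mul, Matrix.one_mul,
    Matrix.smul_mul, trace_sub, trace_smul, trace_mul_comm H]
  simp

theorem trace_inv_add_smul_one_mul_sq_le (hH : 0 ≤ H) (hε : 0 < ε) :
    ((H + ε • (1 : Matrix n n ℂ))⁻¹ * (H * H)).trace.re ≤ H.trace.re := by
  rw [trace_inv_add_smul_one_mul_sq hH hε]
  have := mul_nonneg hε.le (trace_mul_re_nonneg hH (inv_add_smul_one_nonneg hH hε))
  linarith

theorem le_trace_inv_add_smul_one_mul_sq (hH : 0 ≤ H) (hε : 0 < ε) :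
    H.trace.re - ε * Fintype.card n ≤
      ((H + ε • (1 : Matrix n n ℂ))⁻¹ * (H * H)).trace.re := by
  rw [trace_inv_add_smul_one_mul_sq hH hε, mul_inv_add_smul_one hH hε, trace_sub, trace_smul,
    trace_one, Complex.sub_re, Complex.natCast_re, Complex.smul_re, smul_eq_mul]
  have h := mul_nonneg hε.le (trace_re_nonneg (inv_add_smul_one_nonneg hH hε))
  have := mul_nonneg hε.le h
  linarith

/-- The square of `H (H + ε)⁻¹` is a contraction. -/
theorem inv_mul_sq_mul_inv_le_one (hH : 0 ≤ H) (hε : 0 < ε) :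
    (H + ε • (1 : Matrix n n ℂ))⁻¹ * (H * H) * (H + ε • (1 : Matrix n n ℂ))⁻¹ ≤ 1 := by
  have hR := inv_add_smul_one_nonneg hH hε
  have h1 := mul_inv_add_smul_one hH hε
  have h2 := inv_add_smul_one_mul hH hε
  set R := (H + ε • (1 : Matrix n n ℂ))⁻¹
  have hRHR : 0 ≤ R * H * R := by
    have := (hH.posSemidef.mul_mul_conjTranspose_same R).nonneg
    rwa [hR.posSemidef.isHermitian.eq] at this
  have e : R * (H * H) * R = 1 - (ε • R + ε • (R * H * R)) := by
    calc R * (H * H) * R = (R * H) * (H * R) := by simp only [Matrix.mul_assoc]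
      _ = H * R - ε • (R * H * R) := by
        rw [Matrix.mul_assoc R H R, h2, Matrix.sub_mul, Matrix.one_mul, Matrix.smul_mul]
      _ = _ := by rw [h1]; abel
  rw [e]
  exact sub_le_self _ (add_nonneg (hR.posSemidef.smul hε.le).nonneg
    (hRHR.posSemidef.smul hε.le).nonneg)

end Resolvent

/-! ### Weak and strong duality for the squared fidelity -/

section Duality

theorem conj_nonneg {n : Type*} [Fintype n] {A M : Matrix n n ℂ} (hA : A.IsHermitian) (hM : 0 ≤ M) :
    0 ≤ A * M * A := by
  have := (hM.posSemidef.mul_mul_conjTranspose_same A).nonneg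
  rwa [hA.eq] at this

variable {n c : Type*} [Fintype n] [DecidableEq n] [Fintype c] [DecidableEq c]
  {S H : Matrix n n ℂ} {X : Matrix n c ℂ}

/-- Weak duality: every dominating operator bounds the squared fidelity from above. -/
theorem sq_trace_le_of_dominating (hS : 0 ≤ S) (hH : 0 ≤ H) (hHH : H * H = S * (X * Xᴴ) * S)
    {Z : Matrix n n ℂ} (hZ : 0 ≤ Z)
    (h : vecMulVec (ket X) (star (ket X)) ≤ Z ⊗ₖ (1 : Matrix c c ℂ)) :
    H.trace.re ^ 2 ≤ (S * S * Z).trace.re := by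
  have hSh : Sᴴ = S := hS.posSemidef.isHermitian
  have key : ∀ ε : ℝ, 0 < ε →
      H.trace.re ≤ Real.sqrt (S * S * Z).trace.re + ε * Fintype.card n := by
    intro ε hε
    have hR := inv_add_smul_one_nonneg hH hε
    have hR1 := inv_mul_sq_mul_inv_le_one hH hε
    have hlow := le_trace_inv_add_smul_one_mul_sq hH hε
    set R := (H + ε • (1 : Matrix n n ℂ))⁻¹
    have hRh : Rᴴ = R := hR.posSemidef.isHermitian
    -- This test operator turns the left side into `|tr (R H²)|²`, close to `(tr H)²`, while on the
    -- right the contraction `R H² R` is dropped.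
    have h1 := normSq_trace_mul_le hZ h (S * R * S)
    have e1 : (X * Xᴴ * (S * R * S)).trace = (R * (H * H)).trace := by
      rw [hHH, trace_mul_comm R, trace_mul_comm (X * Xᴴ), trace_mul_comm _ R]
      rw [Matrix.mul_assoc S, Matrix.mul_assoc S, trace_mul_comm S]
      simp only [Matrix.mul_assoc]
    have e2 : S * R * S * (X * Xᴴ) * (S * R * S)ᴴ = S * (R * (H * H) * R) * S := by
      simp only [hHH, conjTranspose_mul, hSh, hRh, Matrix.mul_assoc]
    have hle : S * (R * (H * H) * R) * S ≤ S * S := by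
      have := ((Matrix.le_iff.mp hR1).mul_mul_conjTranspose_same S)
      rw [hSh, Matrix.mul_sub, Matrix.sub_mul, Matrix.mul_one] at this
      exact Matrix.le_iff.mpr this
    rw [e1, e2] at h1
    have h2 := h1.trans (trace_mul_re_le_of_le_left hle hZ)
    have h3 : (R * (H * H)).trace.re ^ 2 ≤ (S * S * Z).trace.re := by
      refine le_trans ?_ h2
      rw [Complex.normSq_apply]
      nlinarith [mul_self_nonneg (R * (H * H)).trace.im]
    have h4 := (le_abs_self _).trans (Real.abs_le_sqrt h3)
    linarith
  have hlim : H.trace.re ≤ Real.sqrt (S * S * Z).trace.re := by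
    have ht : Filter.Tendsto (fun ε : ℝ => Real.sqrt (S * S * Z).trace.re + ε * Fintype.card n)
        (nhdsWithin 0 (Set.Ioi 0)) (nhds (Real.sqrt (S * S * Z).trace.re + 0 * Fintype.card n)) :=
      ((by fun_prop : Continuous fun ε : ℝ => Real.sqrt (S * S * Z).trace.re
        + ε * Fintype.card n).tendsto 0).mono_left nhdsWithin_le_nhds
    rw [zero_mul, add_zero] at ht
    exact ge_of_tendsto ht (Filter.eventually_of_mem self_mem_nhdsWithin fun ε hε => key ε hε)
  have hSS : 0 ≤ S * S := by
    have := (posSemidef_conjTranspose_mul_self S).nonneg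
    rwa [hSh] at this
  calc H.trace.re ^ 2 ≤ Real.sqrt (S * S * Z).trace.re ^ 2 :=
        pow_le_pow_left₀ (trace_re_nonneg hH) hlim 2
    _ = _ := Real.sq_sqrt (trace_mul_re_nonneg hSS hZ)

/-- Cyclicity moves `A` around `S²`, and `A S² A` is a contraction when `A` approximates or
generalizes the inverse of `S`. -/
theorem trace_sq_mul_smul_le {A M : Matrix n n ℂ}
    (hA1 : A * (S * S) * A ≤ 1) (hM : 0 ≤ M) {t : ℝ} (ht : 0 ≤ t) :
    (S * S * (t • (A * M * A))).trace.re ≤ t * M.trace.re := by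
  have e : (S * S * (A * M * A)).trace = (A * (S * S) * A * M).trace := by
    rw [Matrix.mul_assoc A M A, trace_mul_comm, Matrix.mul_assoc, trace_mul_comm]
    simp only [Matrix.mul_assoc]
    rw [trace_mul_comm]
    simp only [Matrix.mul_assoc]
  have h := trace_mul_re_le_of_le_left hA1 hM
  rw [Matrix.one_mul] at h
  rw [Matrix.mul_smul, trace_smul, Complex.smul_re, smul_eq_mul, e]
  exact mul_le_mul_of_nonneg_left h ht

/-- Strong duality: the squared fidelity is approached by dominating operators. -/
theorem exists_dominating_trace_lt (hS : 0 ≤ S) (hH : 0 ≤ H) (hHH : H * H = S * (X * Xᴴ) * S)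
    {r : ℝ} (hr : H.trace.re ^ 2 < r) :
    ∃ Z : Matrix n n ℂ, 0 ≤ Z ∧
      vecMulVec (ket X) (star (ket X)) ≤ Z ⊗ₖ (1 : Matrix c c ℂ) ∧
      (S * S * Z).trace.re < r := by
  have hF := trace_re_nonneg hH
  obtain ⟨ε, hεr, hε⟩ : ∃ ε : ℝ,
      H.trace.re * (H + ε • (1 : Matrix n n ℂ)).trace.re < r ∧ 0 < ε := by
    have hc : Continuous fun ε : ℝ => H.trace.re * (H + ε • (1 : Matrix n n ℂ)).trace.re := by
      fun_prop
    have h0 : (fun ε : ℝ => H.trace.re * (H + ε • (1 : Matrix n n ℂ)).trace.re) 0 < r := by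
      simpa [sq] using hr
    have he := (hc.tendsto 0).eventually (gt_mem_nhds h0)
    exact ((he.filter_mono nhdsWithin_le_nhds).and
      (self_mem_nhdsWithin : Set.Ioi (0 : ℝ) ∈ nhdsWithin 0 (Set.Ioi 0))).exists
  have hR := inv_add_smul_one_nonneg hH hε
  have hM := posDef_add_smul_one hH hε
  have hup := trace_inv_add_smul_one_mul_sq_le hH hε
  set M := H + ε • (1 : Matrix n n ℂ)
  have hM0 := trace_re_nonneg hM.posSemidef.nonneg
  -- With `M` fixed, `δ` regularizes the inverse of `S`. Its second use, as a summand, keeps the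
  -- scale factor positive even when the trace vanishes.
  obtain ⟨δ, hδr, hδ⟩ : ∃ δ : ℝ,
      ((M⁻¹ * ((S + δ • (1 : Matrix n n ℂ)) * (X * Xᴴ) * (S + δ • (1 : Matrix n n ℂ)))).trace.re
        + δ) * M.trace.re < r ∧ 0 < δ := by
    have hc : Continuous fun δ : ℝ =>
        ((M⁻¹ * ((S + δ • (1 : Matrix n n ℂ)) * (X * Xᴴ) * (S + δ • (1 : Matrix n n ℂ)))).trace.re
        + δ) * M.trace.re := by
      fun_prop
    have h0 : (fun δ : ℝ =>
        ((M⁻¹ * ((S + δ • (1 : Matrix n n ℂ)) * (X * Xᴴ) * (S + δ • (1 : Matrix n n ℂ)))).trace.re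
        + δ) * M.trace.re) 0 < r := by
      simp only [zero_smul, add_zero]
      rw [← hHH]
      exact (mul_le_mul_of_nonneg_right hup hM0).trans_lt hεr
    have he := (hc.tendsto 0).eventually (gt_mem_nhds h0)
    exact ((he.filter_mono nhdsWithin_le_nhds).and
      (self_mem_nhdsWithin : Set.Ioi (0 : ℝ) ∈ nhdsWithin 0 (Set.Ioi 0))).exists
  have hA0 := inv_add_smul_one_nonneg hS hδ
  have hA1 := inv_mul_sq_mul_inv_le_one hS hδ
  have hB := posDef_add_smul_one hS hδ
  set B := S + δ • (1 : Matrix n n ℂ)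
  have hAh := hA0.posSemidef.isHermitian
  have hconj : 0 ≤ B * (X * Xᴴ) * B :=
    conj_nonneg hB.isHermitian (posSemidef_self_mul_conjTranspose X).nonneg
  have ht0 := trace_mul_re_nonneg hR hconj
  have ht : 0 < (M⁻¹ * (B * (X * Xᴴ) * B)).trace.re + δ := by linarith
  refine ⟨_, ((conj_nonneg hAh hM.posSemidef.nonneg).posSemidef.smul ht.le).nonneg,
    vecMulVec_ket_le_smul hAh hB.isHermitian hM ?_ ht (by linarith),
    (trace_sq_mul_smul_le hA1 hM.posSemidef.nonneg ht.le).trans_lt hδr⟩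
  rw [nonsing_inv_mul _ ((isUnit_iff_isUnit_det _).mp hB.isUnit), Matrix.one_mul]

/-- If `S` has a generalized inverse `A` with `A S X = X`, then the infimum is attained. -/
theorem exists_dominating_trace_le (hS : 0 ≤ S) (hH : 0 ≤ H) (hHH : H * H = S * (X * Xᴴ) * S)
    {A : Matrix n n ℂ} (hA : A.IsHermitian)
    (hA1 : A * (S * S) * A ≤ 1) (hX : A * S * X = X) :
    ∃ Z : Matrix n n ℂ, 0 ≤ Z ∧
      vecMulVec (ket X) (star (ket X)) ≤ Z ⊗ₖ (1 : Matrix c c ℂ) ∧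
      (S * S * Z).trace.re ≤ H.trace.re ^ 2 := by
  have hF := trace_re_nonneg hH
  have hZ : 0 ≤ H.trace.re • (A * H * A) :=
    ((conj_nonneg hA hH).posSemidef.smul hF).nonneg
  refine ⟨H.trace.re • (A * H * A), hZ, ?_, ?_⟩
  · rw [vecMulVec_ket_le_iff hZ]
    intro Y
    -- `H` may be singular, so the factorization applies only to `H + ε`; the scalar test inequality
    -- for each `Y` survives the limit `ε → 0`.
    have hc : Continuous fun ε : ℝ => (Yᴴ * ((H.trace.re + ε) •
        (A * (H + ε • (1 : Matrix n n ℂ)) * A)) * Y).trace.re := by fun_prop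
    have ht := (hc.tendsto 0).mono_left (nhdsWithin_le_nhds (s := Set.Ioi 0))
    simp only [zero_smul, add_zero] at ht
    refine ge_of_tendsto ht (Filter.eventually_of_mem self_mem_nhdsWithin fun ε hε => ?_)
    rw [Set.mem_Ioi] at hε
    have hM := posDef_add_smul_one hH hε
    have htpos : 0 < H.trace.re + ε := by linarith
    refine (vecMulVec_ket_le_iff
      ((conj_nonneg hA hM.posSemidef.nonneg).posSemidef.smul htpos.le).nonneg X).mp
      (vecMulVec_ket_le_smul hA hS.posSemidef.isHermitian hM hX htpos ?_) Y
    rw [← hHH]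
    exact (trace_inv_add_smul_one_mul_sq_le hH hε).trans (by linarith)
  · rw [sq]
    exact trace_sq_mul_smul_le hA1 hH hF

/-- A positive semidefinite matrix has a Hermitian generalized inverse commuting with it. -/
theorem exists_generalized_inverse (hS : 0 ≤ S) :
    ∃ A : Matrix n n ℂ, A.IsHermitian ∧ A * S = S * A ∧ S * A * S = S := by
  have hfin : ∀ f : ℝ → ℝ, ContinuousOn f (spectrum ℝ S) := fun f =>
    (Matrix.finite_real_spectrum (A := S)).continuousOn f
  have hsa : IsSelfAdjoint S := hS.posSemidef.isHermitian
  have hid : cfc (id : ℝ → ℝ) S = S := cfc_id ℝ S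
  refine ⟨cfc (fun x : ℝ => x⁻¹) S, cfc_predicate (R := ℝ) (p := IsSelfAdjoint) _ S, ?_, ?_⟩
  · have := cfc_commute_cfc (fun x : ℝ => x⁻¹) id S
    rw [hid] at this
    exact this.eq
  · nth_rewrite 1 [← hid]
    nth_rewrite 3 [← hid]
    rw [← cfc_mul _ _ S (hfin _) (hfin _), ← cfc_mul _ _ S (hfin _) (hfin _)]
    nth_rewrite 2 [← hid]
    congr 1
    funext x
    simp

/-- The infimum is attained if the kernel of `S` is contained in that of `Xᴴ`. -/
theorem exists_dominating_trace_le_of_ker (hS : 0 ≤ S) (hH : 0 ≤ H)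
    (hHH : H * H = S * (X * Xᴴ) * S) (hker : ∀ v, S *ᵥ v = 0 → Xᴴ *ᵥ v = 0) :
    ∃ Z : Matrix n n ℂ, 0 ≤ Z ∧
      vecMulVec (ket X) (star (ket X)) ≤ Z ⊗ₖ (1 : Matrix c c ℂ) ∧
      (S * S * Z).trace.re ≤ H.trace.re ^ 2 := by
  obtain ⟨A, hA, hcomm, hSAS⟩ := exists_generalized_inverse hS
  have hPh : (A * S).IsHermitian := by
    rw [Matrix.IsHermitian, conjTranspose_mul, hA.eq, hS.posSemidef.isHermitian.eq, hcomm]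
  have hPP : A * S * (A * S) = A * S := by
    rw [Matrix.mul_assoc, ← Matrix.mul_assoc S, hSAS]
  refine exists_dominating_trace_le hS hH hHH hA ?_ ?_
  · have e : A * (S * S) * A = A * S := by
      rw [← hPP]
      nth_rewrite 2 [hcomm]
      simp only [Matrix.mul_assoc]
    -- `A * S` is an orthogonal projection, so its complement is positive.
    have h := (posSemidef_conjTranspose_mul_self (1 - A * S)).nonneg
    rw [(isHermitian_one.sub hPh).eq, Matrix.mul_sub, Matrix.sub_mul, Matrix.sub_mul, hPP] at h
    rw [e]
    simpa using h
  -- The columns of `1 - A * S` lie in the kernel of `S`, hence in that of `Xᴴ`.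
  · have hN : S * (1 - A * S) = 0 := by
      rw [Matrix.mul_sub, Matrix.mul_one, ← Matrix.mul_assoc, hSAS, sub_self]
    have hXN : Xᴴ * (1 - A * S) = 0 := by
      ext i j
      have h1 : S *ᵥ (fun k => (1 - A * S) k j) = 0 := by
        funext k
        exact congrFun (congrFun hN k) j
      exact congrFun (hker _ h1) i
    have h2 := congrArg conjTranspose hXN
    rw [conjTranspose_mul, conjTranspose_conjTranspose, (isHermitian_one.sub hPh).eq,
      conjTranspose_zero, Matrix.sub_mul, Matrix.one_mul] at h2
    exact (sub_eq_zero.mp h2).symm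

end Duality

/-! ### The variational formula relative to a fixed `σ` -/

section RelativeEntropy

variable {a b c : Type*} [Fintype a] [Fintype b]

theorem trace_one_kronecker_mul [DecidableEq a] (σ : Matrix b b ℂ)
    (Z : Matrix (a × b) (a × b) ℂ) :
    ((((1 : Matrix a a ℂ) ⊗ₖ σ) * Z).trace) = (σ * trFst Z).trace := by
  simp only [trace, diag_apply, mul_apply, kroneckerMap_apply, one_apply, trFst, of_apply,
    Fintype.sum_prod_type, ite_mul, one_mul, zero_mul, Finset.mul_sum]
  rw [Finset.sum_comm]
  refine Finset.sum_congr rfl fun i _ => ?_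
  rw [Finset.sum_comm]
  simp only [Finset.sum_comm (s := (Finset.univ : Finset a)) (t := (Finset.univ : Finset b))]
  refine Finset.sum_congr rfl fun j _ => ?_
  simp

theorem trace_trFst (Z : Matrix (a × b) (a × b) ℂ) : (trFst Z).trace = Z.trace := by
  simp only [trace, diag_apply, trFst, of_apply, Fintype.sum_prod_type]
  exact Finset.sum_comm

/-- A vector in the kernel of `1 ⊗ σ` is in the kernel of a purification, if the kernel of `σ` is
contained in that of the marginal. -/
theorem conjTranspose_mulVec_eq_zero_of_ker [Fintype c] [DecidableEq a] {σ : Matrix b b ℂ}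
    {X : Matrix (a × b) c ℂ}
    (hker : ∀ v : b → ℂ, σ *ᵥ v = 0 → trFst (X * Xᴴ) *ᵥ v = 0)
    {w : a × b → ℂ} (hw : ((1 : Matrix a a ℂ) ⊗ₖ σ) *ᵥ w = 0) : Xᴴ *ᵥ w = 0 := by
  -- The marginal is the sum of the positive operators `slice x * (slice x)ᴴ`, so a vector it
  -- annihilates is annihilated by every `(slice x)ᴴ`.
  let slice : a → Matrix b c ℂ := fun x => of fun j k => X (x, j) k
  have hmarg : trFst (X * Xᴴ) = ∑ x, slice x * (slice x)ᴴ := by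
    ext i j
    simp [trFst, slice, mul_apply, Matrix.sum_apply]
  have hslice : ∀ x, (slice x)ᴴ *ᵥ (fun j => w (x, j)) = 0 := by
    intro x
    have h1 : σ *ᵥ (fun j => w (x, j)) = 0 := by
      funext i
      have := congrFun hw (x, i)
      simpa [mulVec, dotProduct, Fintype.sum_prod_type, kroneckerMap_apply, one_apply] using this
    have h2 := hker _ h1
    have h3 : ∑ y, star ((slice y)ᴴ *ᵥ (fun j => w (x, j))) ⬝ᵥ
        ((slice y)ᴴ *ᵥ (fun j => w (x, j))) = 0 := by
      rw [← dotProduct_zero (star fun j => w (x, j)), ← h2, hmarg, sum_mulVec, dotProduct_sum]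
      refine Finset.sum_congr rfl fun y _ => ?_
      rw [← mulVec_mulVec, dotProduct_mulVec (star fun j => w (x, j)), star_mulVec,
        conjTranspose_conjTranspose]
    rw [Finset.sum_eq_zero_iff_of_nonneg fun y _ => dotProduct_star_self_nonneg _] at h3
    exact dotProduct_star_self_eq_zero.mp (h3 x (Finset.mem_univ x))
  funext k
  have : (Xᴴ *ᵥ w) k = ∑ x, ((slice x)ᴴ *ᵥ (fun j => w (x, j))) k := by
    simp [mulVec, dotProduct, Fintype.sum_prod_type, slice]
  rw [this, Pi.zero_apply]
  exact Finset.sum_eq_zero fun x _ => congrFun (hslice x) k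

theorem fidelity_eq_trace_sqrt {n : Type*} [Fintype n] [DecidableEq n] {ρ : Matrix n n ℂ}
    (hρ : 0 ≤ ρ) (τ : Matrix n n ℂ) :
    fidelity ρ τ = (CFC.sqrt (CFC.sqrt τ * ρ * CFC.sqrt τ)).trace.re := by
  have h1 : (CFC.sqrt ρ)ᴴ = CFC.sqrt ρ := (CFC.sqrt_nonneg ρ).posSemidef.isHermitian
  have h2 : (CFC.sqrt τ)ᴴ = CFC.sqrt τ := (CFC.sqrt_nonneg τ).posSemidef.isHermitian
  have h3 : CFC.sqrt ρ * CFC.sqrt ρ = ρ := CFC.sqrt_mul_sqrt_self ρ hρ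
  rw [fidelity, traceNorm, conjTranspose_mul, h1, h2]
  conv_rhs => rw [← h3]
  simp only [Matrix.mul_assoc]

theorem IsPurification.exists_eq_ket {a b c : Type*} [Fintype c]
    {ρABC : Matrix ((a × b) × c) ((a × b) × c) ℂ}
    {ρAB : Matrix (a × b) (a × b) ℂ} (h : IsPurification ρABC ρAB) :
    ∃ X : Matrix (a × b) c ℂ, ρABC = vecMulVec (ket X) (star (ket X)) ∧ ρAB = X * Xᴴ := by
  obtain ⟨⟨ψ, rfl⟩, rfl⟩ := h
  refine ⟨of fun i k => ψ (i, k), rfl, ?_⟩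
  ext i j
  simp [trSnd, vecMulVec_apply, mul_apply]

variable [Fintype c] [DecidableEq a] [DecidableEq b] [DecidableEq c]
  {ρABC : Matrix ((a × b) × c) ((a × b) × c) ℂ} {ρAB : Matrix (a × b) (a × b) ℂ}
  {σ : Matrix b b ℂ}

theorem fidelity_sq_le_of_mem_dominating (hpur : IsPurification ρABC ρAB) (hσ : 0 ≤ σ)
    {Z : Matrix (a × b) (a × b) ℂ} (hZ : Z ∈ dominating ρABC) :
    fidelity ρAB ((1 : Matrix a a ℂ) ⊗ₖ σ) ^ 2 ≤
      (((1 : Matrix a a ℂ) ⊗ₖ σ) * Z).trace.re := by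
  obtain ⟨X, rfl, rfl⟩ := hpur.exists_eq_ket
  have hτ : 0 ≤ (1 : Matrix a a ℂ) ⊗ₖ σ := (PosSemidef.one.kronecker hσ.posSemidef).nonneg
  have hX : 0 ≤ X * Xᴴ := (posSemidef_self_mul_conjTranspose X).nonneg
  have hS := CFC.sqrt_nonneg ((1 : Matrix a a ℂ) ⊗ₖ σ)
  rw [fidelity_eq_trace_sqrt hX]
  have := sq_trace_le_of_dominating hS (CFC.sqrt_nonneg _)
    (CFC.sqrt_mul_sqrt_self _ (conj_nonneg hS.posSemidef.isHermitian hX)) hZ.1 hZ.2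
  rwa [CFC.sqrt_mul_sqrt_self _ hτ] at this

theorem isGLB_trace_dominating (hpur : IsPurification ρABC ρAB) (hσ : 0 ≤ σ) :
    IsGLB ((fun Z => (((1 : Matrix a a ℂ) ⊗ₖ σ) * Z).trace.re) '' dominating ρABC)
      (fidelity ρAB ((1 : Matrix a a ℂ) ⊗ₖ σ) ^ 2) := by
  refine isGLB_of_mem_closure ?_ ?_
  · rintro _ ⟨Z, hZ, rfl⟩
    exact fidelity_sq_le_of_mem_dominating hpur hσ hZ
  · have hlow := fun Z => fidelity_sq_le_of_mem_dominating (Z := Z) hpur hσ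
    rw [Metric.mem_closure_iff]
    intro η hη
    obtain ⟨X, rfl, rfl⟩ := hpur.exists_eq_ket
    have hτ : 0 ≤ (1 : Matrix a a ℂ) ⊗ₖ σ := (PosSemidef.one.kronecker hσ.posSemidef).nonneg
    have hX : 0 ≤ X * Xᴴ := (posSemidef_self_mul_conjTranspose X).nonneg
    have hS := CFC.sqrt_nonneg ((1 : Matrix a a ℂ) ⊗ₖ σ)
    rw [fidelity_eq_trace_sqrt hX] at hlow ⊢
    obtain ⟨Z, hZ, hZX, hlt⟩ := exists_dominating_trace_lt hS (CFC.sqrt_nonneg _)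
      (CFC.sqrt_mul_sqrt_self _ (conj_nonneg hS.posSemidef.isHermitian hX))
      (lt_add_of_pos_right _ hη)
    rw [CFC.sqrt_mul_sqrt_self _ hτ] at hlt
    refine ⟨_, ⟨Z, ⟨hZ, hZX⟩, rfl⟩, ?_⟩
    have := hlow Z ⟨hZ, hZX⟩
    rw [dist_comm, Real.dist_eq, abs_of_nonneg (by linarith)]
    linarith

theorem isLeast_trace_dominating (hpur : IsPurification ρABC ρAB) (hσ : 0 ≤ σ)
    (hker : ∀ v : b → ℂ, σ *ᵥ v = 0 → trFst ρAB *ᵥ v = 0) :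
    IsLeast ((fun Z => (((1 : Matrix a a ℂ) ⊗ₖ σ) * Z).trace.re) '' dominating ρABC)
      (fidelity ρAB ((1 : Matrix a a ℂ) ⊗ₖ σ) ^ 2) := by
  have hlow := (isGLB_trace_dominating hpur hσ).1
  refine ⟨?_, hlow⟩
  obtain ⟨X, rfl, rfl⟩ := hpur.exists_eq_ket
  have hτ : 0 ≤ (1 : Matrix a a ℂ) ⊗ₖ σ := (PosSemidef.one.kronecker hσ.posSemidef).nonneg
  have hX : 0 ≤ X * Xᴴ := (posSemidef_self_mul_conjTranspose X).nonneg
  have hS := CFC.sqrt_nonneg ((1 : Matrix a a ℂ) ⊗ₖ σ)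
  obtain ⟨Z, hZ, hZX, hle⟩ := exists_dominating_trace_le_of_ker hS (CFC.sqrt_nonneg _)
    (CFC.sqrt_mul_sqrt_self _ (conj_nonneg hS.posSemidef.isHermitian hX)) fun v hv => by
      refine conjTranspose_mulVec_eq_zero_of_ker hker ?_
      rw [← CFC.sqrt_mul_sqrt_self _ hτ, ← mulVec_mulVec, hv, mulVec_zero]
  rw [CFC.sqrt_mul_sqrt_self _ hτ, ← fidelity_eq_trace_sqrt hX] at hle
  exact ⟨Z, ⟨hZ, hZX⟩, le_antisymm hle (hlow ⟨Z, ⟨hZ, hZX⟩, rfl⟩)⟩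

end RelativeEntropy

/-! ### Operator norm and compactness of the set of states -/

open scoped Matrix.Norms.L2Operator

section Norm

variable {n : Type*} [Fintype n] [DecidableEq n]

theorem norm_le_trace {A : Matrix n n ℂ} (hA : 0 ≤ A) : ‖A‖ ≤ A.trace.re := by
  rw [CStarAlgebra.norm_le_iff_le_algebraMap A (trace_re_nonneg hA) hA]
  have hh := hA.posSemidef.isHermitian
  have hsa : IsSelfAdjoint A := hh
  refine le_algebraMap_of_spectrum_le fun x hx => ?_
  rw [hh.spectrum_real_eq_range_eigenvalues] at hx
  obtain ⟨i, rfl⟩ := hx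
  have : A.trace.re = ∑ j, hh.eigenvalues j := by
    rw [hh.trace_eq_sum_eigenvalues]
    simp
  rw [this]
  exact Finset.single_le_sum (f := hh.eigenvalues)
    (fun j _ => hA.posSemidef.eigenvalues_nonneg j) (Finset.mem_univ i)

/-- The operator norm of a positive semidefinite matrix as a supremum over states. -/
theorem isLUB_trace_subStates {A : Matrix n n ℂ} (hA : 0 ≤ A) :
    IsLUB ((fun σ => (σ * A).trace.re) '' subStates n) ‖A‖ := by
  constructor
  · rintro _ ⟨σ, hσ, rfl⟩
    have h1 := (CStarAlgebra.norm_le_iff_le_algebraMap A (norm_nonneg A) hA).mp le_rfl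
    have h2 := trace_mul_re_le_of_le_right h1 hσ.1
    rw [Algebra.algebraMap_eq_smul_one, Matrix.mul_smul, Matrix.mul_one, trace_smul,
      Complex.smul_re, smul_eq_mul] at h2
    exact h2.trans (mul_le_of_le_one_right (norm_nonneg A) hσ.2)
  · intro r hr
    have hr0 : 0 ≤ r := by
      have : (0 : Matrix n n ℂ) ∈ subStates n := ⟨le_rfl, by simp⟩
      simpa using hr ⟨0, this, rfl⟩
    -- Homogeneity removes the trace constraint, so that unnormalized rank-one operators can be used
    -- as tests.
    have hscale : ∀ σ : Matrix n n ℂ, 0 ≤ σ → (σ * A).trace.re ≤ r * σ.trace.re := by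
      intro σ hσ
      rcases (trace_re_nonneg hσ).eq_or_lt with h0 | hpos
      · have : σ = 0 := by
          have := norm_le_trace hσ
          rw [← h0] at this
          exact norm_le_zero_iff.mp this
        simp [this]
      · have hmem : (σ.trace.re)⁻¹ • σ ∈ subStates n := by
          refine ⟨(hσ.posSemidef.smul (inv_nonneg.mpr hpos.le)).nonneg, ?_⟩
          rw [trace_smul, Complex.smul_re, smul_eq_mul, inv_mul_cancel₀ hpos.ne']
        have := hr ⟨_, hmem, rfl⟩
        simp only [Matrix.smul_mul, trace_smul, Complex.smul_re, smul_eq_mul] at this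
        rwa [inv_mul_le_iff₀ hpos, mul_comm] at this
    rw [CStarAlgebra.norm_le_iff_le_algebraMap A hr0 hA, Algebra.algebraMap_eq_smul_one,
      Matrix.le_iff]
    have hh : (r • (1 : Matrix n n ℂ) - A).IsHermitian :=
      (PosSemidef.one.smul hr0).isHermitian.sub hA.posSemidef.isHermitian
    refine PosSemidef.of_dotProduct_mulVec_nonneg hh fun v => ?_
    have htr : ∀ M : Matrix n n ℂ, (vecMulVec v (star v) * M).trace = star v ⬝ᵥ M *ᵥ v := by
      intro M
      rw [vecMulVec_mul, trace_vecMulVec, dotProduct_comm, dotProduct_mulVec]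
    have h := hscale _ (posSemidef_vecMulVec_self_star v).nonneg
    rw [htr] at h
    have h1 : (vecMulVec v (star v)).trace = star v ⬝ᵥ v := by
      rw [trace_vecMulVec, dotProduct_comm]
    rw [h1] at h
    have hreal : (star v ⬝ᵥ A *ᵥ v).im = 0 :=
      (Complex.nonneg_iff.mp (hA.posSemidef.dotProduct_mulVec_nonneg v)).2.symm
    have hreal1 : (star v ⬝ᵥ v).im = 0 :=
      (Complex.nonneg_iff.mp (dotProduct_star_self_nonneg v)).2.symm
    rw [sub_mulVec, smul_mulVec, one_mulVec, dotProduct_sub, dotProduct_smul, Complex.nonneg_iff]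
    constructor
    · simpa using h
    · simp [hreal, hreal1]

theorem isClosed_nonneg : IsClosed {A : Matrix n n ℂ | 0 ≤ A} :=
  CStarAlgebra.isClosed_nonneg

theorem isCompact_subStates : IsCompact (subStates n) := by
  have htr : Continuous fun σ : Matrix n n ℂ => σ.trace.re := by fun_prop
  refine Metric.isCompact_of_isClosed_isBounded ?_ ?_
  · exact isClosed_nonneg.inter (isClosed_le htr continuous_const)
  · refine (Metric.isBounded_closedBall (x := (0 : Matrix n n ℂ)) (r := 1)).subset fun σ hσ => ?_
    rw [mem_closedBall_zero_iff]
    exact (norm_le_trace hσ.1).trans hσ.2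

theorem convex_subStates {n : Type*} [Fintype n] : Convex ℝ (subStates n) := by
  intro σ hσ τ hτ s t hs ht hst
  refine ⟨add_nonneg (hσ.1.posSemidef.smul hs).nonneg (hτ.1.posSemidef.smul ht).nonneg, ?_⟩
  have h1 := mul_le_mul_of_nonneg_left hσ.2 hs
  have h2 := mul_le_mul_of_nonneg_left hτ.2 ht
  simp only [trace_add, trace_smul, Complex.add_re, Complex.smul_re, smul_eq_mul]
  linarith

end Norm

/-! ### Exchange of the supremum over states and the infimum over operators -/

section Minimax

variable {a b : Type*} [Fintype a]

theorem continuous_trFst :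
    Continuous (trFst : Matrix (a × b) (a × b) ℂ → Matrix b b ℂ) := by
  refine continuous_matrix fun i j => ?_
  simp only [trFst, of_apply]
  fun_prop

theorem trFst_nonneg {Z : Matrix (a × b) (a × b) ℂ} (hZ : 0 ≤ Z) : 0 ≤ trFst Z := by
  have : trFst Z = ∑ x : a, Z.submatrix (fun j => (x, j)) fun j => (x, j) := by
    ext i j
    simp [trFst, Matrix.sum_apply]
  rw [this]
  exact (posSemidef_sum _ fun x _ => hZ.posSemidef.submatrix _).nonneg

theorem trFst_add (Y Z : Matrix (a × b) (a × b) ℂ) : trFst (Y + Z) = trFst Y + trFst Z := by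
  ext i j
  simp [trFst, Finset.sum_add_distrib]

theorem trFst_smul (t : ℝ) (Z : Matrix (a × b) (a × b) ℂ) : trFst (t • Z) = t • trFst Z := by
  ext i j
  simp [trFst, Finset.mul_sum]

variable [Fintype b] [DecidableEq b]

/-- Makes the norm of the marginal coercive on positive operators, so its sublevel sets are bounded.
-/
theorem trace_re_le_card_mul_norm_trFst {Z : Matrix (a × b) (a × b) ℂ} (hZ : 0 ≤ Z) :
    Z.trace.re ≤ Fintype.card b * ‖trFst Z‖ := by
  have h := trace_re_le_of_le ((CStarAlgebra.norm_le_iff_le_algebraMap (trFst Z)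
    (norm_nonneg _) (trFst_nonneg hZ)).mp le_rfl)
  rw [trace_trFst, Algebra.algebraMap_eq_smul_one, trace_smul, trace_one, Complex.smul_re,
    Complex.natCast_re, smul_eq_mul] at h
  linarith

variable [DecidableEq a]

/-- The norm of the marginal attains its minimum on closed sets of positive operators. -/
theorem exists_isMinOn_norm_trFst {D : Set (Matrix (a × b) (a × b) ℂ)} (hD : IsClosed D)
    (hne : D.Nonempty) (hpos : ∀ Z ∈ D, 0 ≤ Z) :
    ∃ Z ∈ D, ∀ Y ∈ D, ‖trFst Z‖ ≤ ‖trFst Y‖ := by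
  obtain ⟨Z₀, hZ₀⟩ := hne
  have hcont : Continuous fun Z : Matrix (a × b) (a × b) ℂ => ‖trFst Z‖ := continuous_trFst.norm
  have hK : IsCompact (D ∩ {Z | ‖trFst Z‖ ≤ ‖trFst Z₀‖}) := by
    refine Metric.isCompact_of_isClosed_isBounded
      (hD.inter (isClosed_le hcont continuous_const)) ?_
    refine (Metric.isBounded_closedBall (x := (0 : Matrix (a × b) (a × b) ℂ))
      (r := Fintype.card b * ‖trFst Z₀‖)).subset fun Z hZ => ?_
    rw [mem_closedBall_zero_iff]
    exact (norm_le_trace (hpos Z hZ.1)).trans ((trace_re_le_card_mul_norm_trFst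
      (hpos Z hZ.1)).trans (mul_le_mul_of_nonneg_left hZ.2 (Nat.cast_nonneg _)))
  obtain ⟨Z, hZ, hmin⟩ := hK.exists_isMinOn ⟨Z₀, hZ₀, le_refl ‖trFst Z₀‖⟩ hcont.continuousOn
  refine ⟨Z, hZ.1, fun Y hY => ?_⟩
  rcases le_total ‖trFst Y‖ ‖trFst Z₀‖ with h | h
  · exact hmin ⟨hY, h⟩
  · exact (show ‖trFst Z‖ ≤ ‖trFst Z₀‖ from hZ.2).trans h

/-- Minimax for the pairing of states on the second factor with a closed convex set of positive
operators. -/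
theorem exists_isMaxOn_and_isLeast {D : Set (Matrix (a × b) (a × b) ℂ)} (hD : IsClosed D)
    (hconv : Convex ℝ D) (hne : D.Nonempty) (hpos : ∀ Z ∈ D, 0 ≤ Z)
    {g : Matrix b b ℂ → ℝ}
    (hg : ∀ σ ∈ subStates b, IsGLB ((fun Z => (σ * trFst Z).trace.re) '' D) (g σ)) :
    ∃ σ ∈ subStates b, (∀ τ ∈ subStates b, g τ ≤ g σ) ∧
      IsLeast ((fun Z => ‖trFst Z‖) '' D) (g σ) := by
  -- An infimum of continuous functions is upper semicontinuous, hence attains its maximum on the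
  -- compact set of states.
  have husc : UpperSemicontinuousOn g (subStates b) := by
    intro σ hσ y hy
    obtain ⟨_, ⟨Z, hZ, rfl⟩, hlt⟩ := (isGLB_lt_iff (hg σ hσ)).mp hy
    have hc : Continuous fun τ : Matrix b b ℂ => (τ * trFst Z).trace.re := by fun_prop
    filter_upwards [(hc.continuousWithinAt (s := subStates b)).eventually (gt_mem_nhds hlt),
      self_mem_nhdsWithin] with τ hτ hmem
    exact ((hg τ hmem).1 ⟨Z, hZ, rfl⟩).trans_lt hτ
  have hne' : (subStates b).Nonempty := ⟨0, le_rfl, by simp⟩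
  obtain ⟨σ, hσ, hmax⟩ := husc.exists_isMaxOn hne' isCompact_subStates
  obtain ⟨Z, hZ, hmin⟩ := exists_isMinOn_norm_trFst hD hne hpos
  have hcY : ∀ Y : Matrix (a × b) (a × b) ℂ,
      Continuous fun τ : Matrix b b ℂ => -(τ * trFst Y).trace.re := fun Y => by fun_prop
  have hcσ : ∀ τ : Matrix b b ℂ,
      Continuous fun Y : Matrix (a × b) (a × b) ℂ => -(τ * trFst Y).trace.re := fun τ => by
    have := continuous_trFst (a := a) (b := b)
    fun_prop
  -- The pairing is negated because this form of Sion's theorem minimizes over the compact set,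
  -- whereas here the states are maximized over.
  have key := Sion.minimax (X := subStates b) (Y := D)
    (f := fun σ Z => -(σ * trFst Z).trace.re) hne' isCompact_subStates
    (fun Y _ => (hcY Y).continuousOn.lowerSemicontinuousOn)
    (fun Y _ => by
      refine ConvexOn.quasiconvexOn ⟨convex_subStates, fun σ _ τ _ s t _ _ _ => le_of_eq ?_⟩
      simp only [Matrix.add_mul, Matrix.smul_mul, trace_add, trace_smul, Complex.add_re,
        Complex.smul_re, smul_eq_mul]
      ring)
    hconv
    (fun τ _ => (hcσ τ).continuousOn.upperSemicontinuousOn)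
    (fun τ _ => by
      refine ConcaveOn.quasiconcaveOn ⟨hconv, fun Y _ Z _ s t _ _ _ => le_of_eq ?_⟩
      simp only [trFst_add, trFst_smul, Matrix.mul_add, Matrix.mul_smul, trace_add, trace_smul,
        Complex.add_re, Complex.smul_re, smul_eq_mul]
      ring)
    convex_subStates
    (fun τ => -g τ) (fun τ hτ => by
      have := (hg τ hτ).neg
      rwa [← Set.image_neg_eq_neg, Set.image_image] at this)
    (-g σ) (IsLeast.isGLB ⟨⟨σ, hσ, rfl⟩, by
      rintro _ ⟨τ, hτ, rfl⟩
      exact neg_le_neg (hmax hτ)⟩)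
    (fun Y => -‖trFst Y‖) (fun Y hY => by
      have := (isLUB_trace_subStates (trFst_nonneg (hpos Y hY))).neg
      rwa [← Set.image_neg_eq_neg, Set.image_image] at this)
    (-‖trFst Z‖) (IsGreatest.isLUB ⟨⟨Z, hZ, rfl⟩, by
      rintro _ ⟨Y, hY, rfl⟩
      exact neg_le_neg (hmin Y hY)⟩)
  rw [neg_inj] at key
  refine ⟨σ, hσ, fun τ hτ => hmax hτ, ⟨Z, hZ, key.symm⟩, ?_⟩
  rintro _ ⟨Y, hY, rfl⟩
  rw [key]
  exact hmin Y hY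

end Minimax

/-! ### Convexity and closedness of the dominating set -/

section Dominating

theorem log2_mono : Monotone log2 := by
  intro x y hxy
  unfold log2
  split_ifs with hx hy hy
  · exact le_rfl
  · exact bot_le
  · exact absurd (hxy.trans hy) hx
  · exact EReal.coe_le_coe_iff.mpr
      (Real.logb_le_logb_of_le one_lt_two (not_le.mp hx) hxy)

variable {a b c : Type*} [DecidableEq c]
  (ρABC : Matrix ((a × b) × c) ((a × b) × c) ℂ)

theorem convex_dominating : Convex ℝ (dominating ρABC) := by
  intro Y hY Z hZ s t hs ht hst
  refine ⟨add_nonneg (hY.1.posSemidef.smul hs).nonneg (hZ.1.posSemidef.smul ht).nonneg, ?_⟩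
  have h : (s • Y + t • Z) ⊗ₖ (1 : Matrix c c ℂ) - ρABC =
      s • (Y ⊗ₖ (1 : Matrix c c ℂ) - ρABC) + t • (Z ⊗ₖ (1 : Matrix c c ℂ) - ρABC) := by
    rw [smul_sub, smul_sub, sub_add_sub_comm, ← add_smul, hst, one_smul, add_kronecker,
      smul_kronecker, smul_kronecker]
  rw [Matrix.le_iff, h]
  exact ((Matrix.le_iff.mp hY.2).smul hs).add ((Matrix.le_iff.mp hZ.2).smul ht)

variable [Fintype a] [Fintype b] [Fintype c] [DecidableEq a] [DecidableEq b]

theorem isClosed_dominating : IsClosed (dominating ρABC) := by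
  have h1 : Continuous fun Z : Matrix (a × b) (a × b) ℂ =>
      Z ⊗ₖ (1 : Matrix c c ℂ) - ρABC := by
    refine continuous_matrix fun i j => ?_
    simp only [Matrix.sub_apply, kroneckerMap_apply]
    fun_prop
  have : dominating ρABC = {Z | 0 ≤ Z} ∩
      (fun Z => Z ⊗ₖ (1 : Matrix c c ℂ) - ρABC) ⁻¹' {M | 0 ≤ M} := by
    ext Z
    simp [dominating, sub_nonneg]
  rw [this]
  exact isClosed_nonneg.inter (isClosed_nonneg.preimage h1)

end Dominating

end MaxEntropy

theorem mainTheorem6 {a b c : Type*} [Fintype a] [Fintype b] [Fintype c]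
    [DecidableEq a] [DecidableEq b] [DecidableEq c]
    (ρAB : Matrix (a × b) (a × b) ℂ) (hρ : ρAB ∈ MaxEntropy.subStates (a × b))
    (ρABC : Matrix ((a × b) × c) ((a × b) × c) ℂ)
    (hpur : MaxEntropy.IsPurification ρABC ρAB) :
    -- the maximum over `σ` in the definition of the max-entropy is attained
    (∃ σ ∈ MaxEntropy.subStates b, MaxEntropy.hmaxRel ρAB σ = MaxEntropy.hmax ρAB) ∧
    -- the max-entropy as a minimum
    (∃ m : ℝ,
      IsLeast ((fun Z => MaxEntropy.opNorm (MaxEntropy.trFst Z)) ''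
        MaxEntropy.dominating ρABC) m ∧
      MaxEntropy.hmax ρAB = MaxEntropy.log2 m) ∧
    -- the max-entropy relative to a fixed `σ`
    (∀ σ ∈ MaxEntropy.subStates b, ∃ m : ℝ,
      IsGLB ((fun Z => (((1 : Matrix a a ℂ) ⊗ₖ σ) * Z).trace.re) ''
        MaxEntropy.dominating ρABC) m ∧
      ((∀ v : b → ℂ, σ.mulVec v = 0 → (MaxEntropy.trFst ρAB).mulVec v = 0) →
        IsLeast ((fun Z => (((1 : Matrix a a ℂ) ⊗ₖ σ) * Z).trace.re) ''
          MaxEntropy.dominating ρABC) m) ∧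
      MaxEntropy.hmaxRel ρAB σ = MaxEntropy.log2 m) := by
  have hglb := fun σ (hσ : σ ∈ MaxEntropy.subStates b) =>
    MaxEntropy.isGLB_trace_dominating hpur hσ.1
  -- The empty set of reals has no greatest lower bound, so the formula at `σ = 0` already forces a
  -- dominating operator to exist.
  have hne : (MaxEntropy.dominating ρABC).Nonempty :=
    Set.image_nonempty.mp (hglb 0 ⟨le_rfl, by simp⟩).nonempty
  obtain ⟨σ, hσ, hmax, hleast⟩ := MaxEntropy.exists_isMaxOn_and_isLeast
    (MaxEntropy.isClosed_dominating ρABC) (MaxEntropy.convex_dominating ρABC) hne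
    (fun Z hZ => hZ.1)
    (g := fun σ => MaxEntropy.fidelity ρAB ((1 : Matrix a a ℂ) ⊗ₖ σ) ^ 2)
    (fun σ hσ => by
      simpa only [MaxEntropy.trace_one_kronecker_mul] using hglb σ hσ)
  have heq : MaxEntropy.hmaxRel ρAB σ = MaxEntropy.hmax ρAB :=
    le_antisymm (le_iSup₂ (f := fun σ _ => MaxEntropy.hmaxRel ρAB σ) σ hσ)
      (iSup₂_le fun τ hτ => MaxEntropy.log2_mono (hmax τ hτ))
  exact ⟨⟨σ, hσ, heq⟩, ⟨_, hleast, heq.symm⟩, fun τ hτ => ⟨_, hglb τ hτ,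
    MaxEntropy.isLeast_trace_dominating hpur hτ.1, rfl⟩⟩
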